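/- Let $\Delta$ be the set of monotone maps $f:[0,\infty]\to[0,1]$ satisfying $f(t)=\sup_{s<t}f(s)$ for all $t\in[0,\infty]$, ordered pointwise. With the tensor $(f\otimes g)(t)=\sup_{r+s\le t}f(r)\cdot g(s)$ and the neutral element $\varepsilon$ given by $\varepsilon(0)=0$ and $\varepsilon(t)=1$ for $t>0$, it is a commutative quantale; let $\hom(f,g)=\bigvee\{h\in\Delta\mid f\otimes h\le g\}$. A probabilistic metric space (a $\Delta$-category) is a set $X$ with a map $a:X\times X\to\Delta$ such that $\varepsilon\le a(x,x)$ and $a(x,y)\otimes a(y,z)\le a(x,z)$ for all $x,y,z\in X$. Let $\mathsf{ProbMet}$ be the category of probabilistic metric spaces whose morphisms $f:(X,a)\to(Y,b)$ are the maps $f:X\to Y$ with $a(x,y)\le b(f(x),f(y))$ for all $x,y\in X$; such an $f$ is fully faithful if equality always holds. A probabilistic metric space $X=(X,a)$ is injective if for every fully faithful $i:A\to B$ and every $f:A\to X$ in $\mathsf{ProbMet}$ there is $g:B\to X$ in $\mathsf{ProbMet}$ with $g\cdot i\simeq f$, that is, $\varepsilon\le a(g(i(x)),f(x))$ and $\varepsilon\le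 a(f(x),g(i(x)))$ for all $x\in A$. An object $X$ of a category $\mathsf{C}$ with finite products is exponentiable if the functor $X\times-:\mathsf{C}\to\mathsf{C}$ has a right adjoint, and a category is Cartesian closed if it has finite products and all its objects are exponentiable. Theorem. Every injective probabilistic metric space is exponentiable in $\mathsf{ProbMet}$. In particular, $\Delta=(\Delta,\hom)$ is exponentiable in $\mathsf{ProbMet}$. Furthermore, the full subcategory of $\mathsf{ProbMet}$ defined by all injective probabilistic metric spaces is Cartesian closed. -/

import Mathlib

open CategoryTheory CategoryTheory.Limits
open scoped ENNReal unitInterval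

/-! ## Categories enriched in a commutative unital quantale -/

universe w v

/-- A `V`-category for a quantale `V = (V, ⊗, k)` (tensor `*`, neutral element `1`): a set
with a map `dist : X × X → V` such that `k ≤ dist x x` and
`dist x y ⊗ dist y z ≤ dist x z`. -/
structure VCat (V : Type v) [CommMonoid V] [CompleteLattice V] [IsQuantale V] :
    Type (max (w + 1) v) where
  carrier : Type w
  dist : carrier → carrier → V
  one_le_dist : ∀ x, 1 ≤ dist x x
  dist_mul_dist_le : ∀ x y z, dist x y * dist y z ≤ dist x z

namespace VCat

variable {V : Type v} [CommMonoid V] [CompleteLattice V] [IsQuantale V]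

/-- A `V`-functor `(X, a) → (Y, b)`: a map `f` with `a x y ≤ b (f x) (f y)`. -/
@[ext]
structure Hom (X Y : VCat.{w} V) : Type w where
  toFun : X.carrier → Y.carrier
  dist_le : ∀ x y, X.dist x y ≤ Y.dist (toFun x) (toFun y)

/-- The category of `V`-categories and `V`-functors. -/
instance : Category.{w} (VCat.{w} V) where
  Hom X Y := Hom X Y
  id X := ⟨fun x => x, fun _ _ => le_rfl⟩
  comp f g := ⟨fun x => g.toFun (f.toFun x),
    fun x y => (f.dist_le x y).trans (g.dist_le _ _)⟩

@[ext]
theorem hom_ext {X Y : VCat.{w} V} {f g : X ⟶ Y} (h : ∀ x, f.toFun x = g.toFun x) : f = g :=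
  Hom.ext (funext h)

@[simp]
theorem id_toFun (X : VCat.{w} V) (x : X.carrier) : Hom.toFun (𝟙 X) x = x := rfl

@[simp]
theorem comp_toFun {X Y Z : VCat.{w} V} (f : X ⟶ Y) (g : Y ⟶ Z) (x : X.carrier) :
    (f ≫ g).toFun x = g.toFun (f.toFun x) := rfl

/-- Equivalence of points: `x ≃ y` when `x ≤ y` and `y ≤ x` in the underlying order, where
`x ≤ y` means `k ≤ dist x y`. -/
def Equivalent (X : VCat.{w} V) (x y : X.carrier) : Prop :=
  1 ≤ X.dist x y ∧ 1 ≤ X.dist y x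

/-- `f` is fully faithful: `a x y = b (f x) (f y)`. -/
def IsFullyFaithful {X Y : VCat.{w} V} (f : X ⟶ Y) : Prop :=
  ∀ x y, X.dist x y = Y.dist (f.toFun x) (f.toFun y)

/-- `X` is injective: every `V`-functor `f : A → X` extends, up to pointwise equivalence, along
every fully faithful `V`-functor `i : A → B`. -/
def IsInjective (X : VCat.{w} V) : Prop :=
  ∀ (A B : VCat.{w} V) (i : A ⟶ B), IsFullyFaithful i →
    ∀ f : A ⟶ X, ∃ g : B ⟶ X, ∀ x, X.Equivalent ((i ≫ g).toFun x) (f.toFun x)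

open scoped Quantale in
/-- The quantale `V` as a `V`-category, `dist u v` being the residual
`hom u v = ⋁ {h | u ⊗ h ≤ v}`. The `ULift` allows any universe of underlying sets. -/
def self (V : Type v) [CommMonoid V] [CompleteLattice V] [IsQuantale V] :
    VCat.{max v w} V where
  carrier := ULift.{w} V
  dist u v := u.down ⇨ᵣ v.down
  one_le_dist u := by
    rw [Quantale.rightMulResiduation_le_iff_mul_le, mul_one]
  dist_mul_dist_le x y z := by
    rw [Quantale.rightMulResiduation_le_iff_mul_le, ← mul_assoc]
    exact (mul_le_mul_left (Quantale.rightMulResiduation_le_iff_mul_le.1 le_rfl) _).trans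
      (Quantale.rightMulResiduation_le_iff_mul_le.1 le_rfl)

/-- The terminal `V`-category. -/
def terminal (V : Type v) [CommMonoid V] [CompleteLattice V] [IsQuantale V] : VCat.{w} V where
  carrier := PUnit
  dist _ _ := ⊤
  one_le_dist _ := le_top
  dist_mul_dist_le _ _ _ := le_top

/-- The binary product: `dist (x, y) (x', y') = dist x x' ⊓ dist y y'`. -/
def prodObj (X Y : VCat.{w} V) : VCat.{w} V where
  carrier := X.carrier × Y.carrier
  dist p q := X.dist p.1 q.1 ⊓ Y.dist p.2 q.2
  one_le_dist _ := le_inf (X.one_le_dist _) (Y.one_le_dist _)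
  dist_mul_dist_le _ _ _ := le_inf
    ((mul_le_mul' inf_le_left inf_le_left).trans (X.dist_mul_dist_le _ _ _))
    ((mul_le_mul' inf_le_right inf_le_right).trans (Y.dist_mul_dist_le _ _ _))

/-- The first projection. -/
def prodFst (X Y : VCat.{w} V) : prodObj X Y ⟶ X := Hom.mk Prod.fst fun _ _ => inf_le_left

/-- The second projection. -/
def prodSnd (X Y : VCat.{w} V) : prodObj X Y ⟶ Y := Hom.mk Prod.snd fun _ _ => inf_le_right

/-- The pairing of two `V`-functors. -/
def prodLift {T X Y : VCat.{w} V} (f : T ⟶ X) (g : T ⟶ Y) : T ⟶ prodObj X Y :=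
  Hom.mk (fun t => (f.toFun t, g.toFun t)) fun x y => le_inf (f.dist_le x y) (g.dist_le x y)

/-- `prodObj X Y` with its projections is a categorical product. -/
def prodIsLimit (X Y : VCat.{w} V) : IsLimit (BinaryFan.mk (prodFst X Y) (prodSnd X Y)) :=
  BinaryFan.isLimitMk (fun s => prodLift s.fst s.snd) (fun _ => rfl) (fun _ => rfl)
    fun _ _ h₁ h₂ => hom_ext fun t =>
      Prod.ext (congrArg (fun f => Hom.toFun f t) h₁) (congrArg (fun f => Hom.toFun f t) h₂)

/-- `terminal V` is a terminal object. -/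
def terminalIsTerminal (V : Type v) [CommMonoid V] [CompleteLattice V] [IsQuantale V] :
    IsTerminal (terminal.{w} V) :=
  IsTerminal.ofUniqueHom (fun _ => Hom.mk (fun _ => PUnit.unit) fun _ _ => le_top)
    fun _ _ => rfl

instance : HasFiniteProducts (VCat.{w} V) := by
  have : HasTerminal (VCat.{w} V) := (terminalIsTerminal.{w} V).hasTerminal
  have : ∀ X Y : VCat.{w} V, HasLimit (pair X Y) := fun X Y => ⟨⟨⟨_, prodIsLimit X Y⟩⟩⟩
  have : HasBinaryProducts (VCat.{w} V) := hasBinaryProducts_of_hasLimit_pair _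
  exact hasFiniteProducts_of_has_binary_and_terminal

end VCat

/-! ## Exponentiable objects and Cartesian closed categories -/

universe v₁ u₁

/-- `X` is exponentiable: the functor `X × - : C ⥤ C` has a right adjoint. -/
def IsExponentiableObject {C : Type u₁} [Category.{v₁} C] [HasFiniteProducts C] (X : C) : Prop :=
  (prod.functor.obj X).IsLeftAdjoint

/-- `C` is Cartesian closed: it has finite products and all its objects are exponentiable. -/
def IsCartesianClosed (C : Type u₁) [Category.{v₁} C] : Prop :=
  ∃ _ : HasFiniteProducts C, ∀ X : C, IsExponentiableObject X

/-! ## The quantale of distribution functions -/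

/-- The set `Δ` of distribution functions: monotone maps `f : [0, ∞] → [0, 1]` with
`f t = ⋁_{s < t} f s` for all `t`. In particular `f 0 = 0`. -/
@[ext]
structure DistFun where
  toFun : ℝ≥0∞ → I
  monotone' : Monotone toFun
  left_continuous' : ∀ t, toFun t = ⨆ s : ℝ≥0∞, ⨆ _ : s < t, toFun s

namespace DistFun

instance : CoeFun DistFun fun _ => ℝ≥0∞ → I := ⟨toFun⟩

theorem left_continuous (f : DistFun) (t : ℝ≥0∞) : f t = ⨆ s : ℝ≥0∞, ⨆ _ : s < t, f s :=
  f.left_continuous' t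

/-- A map that satisfies the inequality in the left-continuity condition and is monotone is a
distribution function. -/
def ofLE (f : ℝ≥0∞ → I) (hm : Monotone f)
    (h : ∀ t, f t ≤ ⨆ s : ℝ≥0∞, ⨆ _ : s < t, f s) : DistFun :=
  ⟨f, hm, fun t => le_antisymm (h t) (iSup₂_le fun _ hs => hm hs.le)⟩

theorem toFun_injective : Function.Injective DistFun.toFun := fun _ _ => DistFun.ext

/-- The pointwise order. -/
instance : PartialOrder DistFun := PartialOrder.lift DistFun.toFun toFun_injective

theorem le_def {f g : DistFun} : f ≤ g ↔ ∀ t, f t ≤ g t := Iff.rfl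

/-- Suprema are pointwise. -/
noncomputable instance : SupSet DistFun where
  sSup S := ofLE (fun t => ⨆ f : DistFun, ⨆ _ : f ∈ S, f t)
    (fun _ _ h => iSup₂_mono fun f _ => f.monotone' h) fun t => iSup₂_le fun f hf => by
      rw [f.left_continuous t]
      exact iSup₂_mono fun s _ => le_iSup₂ (f := fun (f : DistFun) (_ : f ∈ S) => f s) f hf

theorem sSup_apply (S : Set DistFun) (t : ℝ≥0∞) :
    (sSup S : DistFun) t = ⨆ f : DistFun, ⨆ _ : f ∈ S, f t := rfl

noncomputable instance : CompleteLattice DistFun :=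
  completeLatticeOfSup DistFun fun S =>
    ⟨fun f hf t => le_iSup₂ (f := fun (f : DistFun) (_ : f ∈ S) => f t) f hf,
      fun _ hg t => iSup₂_le fun _ hf => hg hf t⟩

theorem mul_iSup {ι : Sort*} (u : I) (x : ι → I) : u * ⨆ i, x i = ⨆ i, u * x i :=
  Monotone.map_iSup_of_continuousAt (f := fun y : I => u * y)
    (continuous_const.mul continuous_id).continuousAt (fun _ _ h => mul_le_mul_right h u)
    (mul_zero u)

theorem iSup_mul {ι : Sort*} (u : I) (x : ι → I) : (⨆ i, x i) * u = ⨆ i, x i * u := by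
  simp only [mul_comm _ u, mul_iSup]

/-- The tensor (convolution) `(f ⊗ g)(t) = ⋁_{r + s ≤ t} f(r) · g(s)`. -/
noncomputable instance : Mul DistFun where
  mul f g := ofLE (fun t => ⨆ r : ℝ≥0∞, ⨆ s : ℝ≥0∞, ⨆ _ : r + s ≤ t, f r * g s)
    (fun _ _ h => iSup₂_mono fun _ _ => iSup_mono' fun h' => ⟨h'.trans h, le_rfl⟩)
    fun t => iSup₂_le fun r s => iSup_le fun hrs => by
      rw [f.left_continuous r, g.left_continuous s]
      simp only [mul_iSup, iSup_mul]
      refine iSup₂_le fun s' hs => iSup₂_le fun r' hr => ?_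
      refine le_iSup₂_of_le (r' + s') ((ENNReal.add_lt_add hr hs).trans_le hrs) ?_
      exact le_iSup₂_of_le r' s' (le_iSup_of_le le_rfl le_rfl)

theorem mul_apply (f g : DistFun) (t : ℝ≥0∞) :
    (f * g) t = ⨆ r : ℝ≥0∞, ⨆ s : ℝ≥0∞, ⨆ _ : r + s ≤ t, f r * g s := rfl

/-- The neutral element `ε`, with `ε(0) = 0` and `ε(t) = 1` for `t > 0`. -/
noncomputable instance : One DistFun where
  one := ofLE (fun t => if t = 0 then 0 else 1)
    (fun s t h => by
      by_cases hs : s = 0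
      · simp [hs]
      · simp [hs, ((pos_iff_ne_zero.2 hs).trans_le h).ne'])
    fun t => by
      by_cases ht : t = 0
      · rw [if_pos ht]; exact bot_le
      · obtain ⟨s, hs, hst⟩ := exists_between (pos_iff_ne_zero.2 ht)
        refine le_iSup₂_of_le s hst ?_
        simp [ht, hs.ne']

theorem one_apply (t : ℝ≥0∞) : (1 : DistFun) t = if t = 0 then 0 else 1 := rfl

theorem apply_zero (f : DistFun) : f 0 = 0 := by
  rw [f.left_continuous 0]
  exact le_antisymm (iSup₂_le fun s hs => absurd hs not_lt_zero) bot_le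

theorem mul_le_iff {f g h : DistFun} : f * g ≤ h ↔ ∀ r s, f r * g s ≤ h (r + s) := by
  refine ⟨fun H r s => le_trans ?_ (H (r + s)), fun H t => ?_⟩
  · exact le_iSup₂_of_le r s (le_iSup_of_le le_rfl le_rfl)
  · exact iSup₂_le fun r s => iSup_le fun hrs => (H r s).trans (h.monotone' hrs)

theorem mul_comm' (f g : DistFun) : f * g = g * f := by
  refine eq_of_forall_ge_iff fun h => ?_
  rw [mul_le_iff, mul_le_iff, forall_comm]
  simp only [mul_comm, add_comm]

theorem mul_mul_le_iff {f g h k : DistFun} :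
    f * g * h ≤ k ↔ ∀ r s t, f r * g s * h t ≤ k (r + s + t) := by
  rw [mul_le_iff]
  refine ⟨fun H r s t => ?_, fun H r t => ?_⟩
  · exact (mul_le_mul_left (mul_le_iff.1 le_rfl r s) _).trans (H (r + s) t)
  · rw [mul_apply]
    simp only [iSup_mul]
    exact iSup₂_le fun p q => iSup_le fun hpq =>
      (H p q t).trans (k.monotone' (add_le_add_left hpq t))

theorem one_mul' (f : DistFun) : 1 * f = f := by
  refine eq_of_forall_ge_iff fun h => ?_
  rw [mul_le_iff]
  refine ⟨fun H t => ?_, fun H r s => ?_⟩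
  · rw [f.left_continuous t]
    refine iSup₂_le fun s hs => ?_
    obtain ⟨r, hr⟩ := exists_between hs
    have := H (t - s) s
    rw [tsub_add_cancel_of_le hs.le, one_apply, if_neg (tsub_pos_of_lt hs).ne', one_mul] at this
    exact this
  · rw [one_apply]
    split_ifs
    · rw [zero_mul]; exact bot_le
    · rw [one_mul]; exact (H s).trans (h.monotone' le_add_self)

noncomputable instance : CommMonoid DistFun where
  mul_assoc f g h := by
    refine eq_of_forall_ge_iff fun k => ?_
    rw [mul_mul_le_iff, mul_comm' f, mul_mul_le_iff]
    constructor <;> intro H r s t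
    · have := H t r s
      rwa [mul_assoc, mul_comm, add_assoc, add_comm] at this
    · have := H s t r
      rwa [mul_comm, ← mul_assoc, add_comm, ← add_assoc] at this
  one_mul := one_mul'
  mul_one f := by rw [mul_comm', one_mul']
  mul_comm := mul_comm'

theorem mul_sSup' (f : DistFun) (S : Set DistFun) : f * sSup S = ⨆ g ∈ S, f * g := by
  refine eq_of_forall_ge_iff fun h => ?_
  rw [mul_le_iff, iSup₂_le_iff]
  simp only [mul_le_iff, sSup_apply, mul_iSup, iSup_le_iff]
  exact ⟨fun H g hg r s => H r s g hg, fun H r s g hg => H g hg r s⟩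

instance : IsQuantale DistFun where
  mul_sSup_distrib := mul_sSup'
  sSup_mul_distrib S f := by
    rw [mul_comm', mul_sSup']
    simp only [mul_comm' f]

end DistFun

/-- The category of probabilistic metric spaces, that is, of `Δ`-categories: a distribution
function `dist x y` for each pair of points, and maps `f` with
`dist x y t ≤ dist (f x) (f y) t`. -/
abbrev ProbMet : Type (w + 1) := VCat.{w} DistFun

/-- The full subcategory of `ProbMet` defined by the injective objects. -/
abbrev InjProbMet : Type (w + 1) :=
  ObjectProperty.FullSubcategory (fun X : ProbMet.{w} => X.IsInjective)

/-!
A `V`-category `(X, a)` is exponentiable as soon as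
`a x z ⊓ (u ⊗ v) ≤ ⋁ y, (a x y ⊓ u) ⊗ (a y z ⊓ v)` for all points `x`, `z` and all `u v : V`
(`VCat.IsInterpolating`): when `V` is a frame whose neutral element is its top element, the
candidate exponential `Y ^ X` is the set of `V`-functors `X → Y`, the distance from `f` to `g`
being the largest `u` with `a x x' ⊓ u ≤ b (f x) (g x')` for all `x`, `x'`, and the displayed
inequality is what its triangle inequality needs.

An injective `V`-category meets this condition if `w ⊓ (u ⊗ v)` is the supremum of the elements
`u' ⊗ v' ≤ w` with `u' ≤ u` and `v' ≤ v` (`CartesianQuantale.inf_mul_le`). Indeed, let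
`u' ⊗ v' ≤ a x z`. The chain `0 → 1` with distance `a x z` sits fully faithfully in a chain
`0 → m → 1` with intermediate distances `u'` and `v'`; extending the map `0 ↦ x`, `1 ↦ z` along
this inclusion sends `m` to a point `y` with `u' ≤ a x y` and `v' ≤ a y z`.

For distribution functions this property of the quantale comes from step functions
(`DistFun.step`): near a point `r + s`, the functions `u`, `v` and `w` are replaced by their values
at some `r' < r`, `s' < s` and `r' + s'`, and a number below `u r' * v s'` is a product of numbers
below `u r'` and `v s'`.

The quantale itself is injective by the formula for left Kan extensions, and products and
exponentials of injective `V`-categories are injective, the latter by transposing the extension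
problem; so injective `V`-categories form a Cartesian closed category.
-/

/-! ### Exponentiability from chosen products -/

/-- To exhibit `X` as exponentiable, any choice of products `P A` of `X` with the objects `A` may
be used in place of `X ⨯ A`. -/
theorem isExponentiableObject_of_equiv {C : Type u₁} [Category.{v₁} C] [HasFiniteProducts C]
    {X : C} (P : C → C) (fst : ∀ A, P A ⟶ X) (snd : ∀ A, P A ⟶ A)
    (hP : ∀ A, IsLimit (BinaryFan.mk (fst A) (snd A))) (E : C → C)
    (e : ∀ A Y, (P A ⟶ Y) ≃ (A ⟶ E Y))
    (he : ∀ {A A' Y} (f : A' ⟶ A) (p : P A' ⟶ P A) (g : P A ⟶ Y),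
      p ≫ fst A = fst A' → p ≫ snd A = snd A' ≫ f → e A' Y (p ≫ g) = f ≫ e A Y g) :
    IsExponentiableObject X := by
  let i : ∀ A, P A ≅ X ⨯ A := fun A => (hP A).conePointUniqueUpToIso (limit.isLimit (pair X A))
  have hfst : ∀ A, (i A).hom ≫ prod.fst = fst A := fun A =>
    (hP A).conePointUniqueUpToIso_hom_comp (limit.isLimit (pair X A)) ⟨WalkingPair.left⟩
  have hsnd : ∀ A, (i A).hom ≫ prod.snd = snd A := fun A =>
    (hP A).conePointUniqueUpToIso_hom_comp (limit.isLimit (pair X A)) ⟨WalkingPair.right⟩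
  -- The right adjoint has object map `E`; `prod.map (𝟙 X) f`, conjugated by `i`, serves as `p`.
  refine ⟨_, ⟨Adjunction.adjunctionOfEquivRight (F := prod.functor.obj X) (G_obj := E)
    (fun A Y => ((i A).symm.homFromEquiv (Z := Y)).trans (e A Y))
    fun A' A Y f (g : X ⨯ A ⟶ Y) => ?_⟩⟩
  have h := he f ((i A').hom ≫ prod.map (𝟙 X) f ≫ (i A).inv) ((i A).hom ≫ g)
    (by simp [← hfst]) (by simp [← hsnd])
  rw [Category.assoc, Category.assoc, Iso.inv_hom_id_assoc] at h
  exact h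

/-! ### The condition on the quantale -/

/-- A quantale whose underlying lattice is a frame, whose neutral element is the top element, and
in which `w ⊓ (u * v)` is the supremum of the elements `u' * v' ≤ w` with `u' ≤ u` and
`v' ≤ v`. -/
class CartesianQuantale (V : Type v) [CommMonoid V] [CompleteLattice V] : Prop where
  le_one : ∀ u : V, u ≤ 1
  inf_sSup_le : ∀ (u : V) (S : Set V), u ⊓ sSup S ≤ ⨆ s ∈ S, u ⊓ s
  inf_mul_le : ∀ u v w q : V,
    (∀ u' ≤ u, ∀ v' ≤ v, u' * v' ≤ w → u' * v' ≤ q) → w ⊓ (u * v) ≤ q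

namespace VCat

variable {V : Type v} [CommMonoid V] [CompleteLattice V] [IsQuantale V]

/-! ### Injective enriched categories -/

theorem isInjective_terminal : (terminal.{w} V).IsInjective := fun _ _ _ _ _ =>
  ⟨Hom.mk (fun _ => PUnit.unit) fun _ _ => le_top, fun _ => ⟨le_top, le_top⟩⟩

theorem IsInjective.prodObj {X Y : VCat.{w} V} (hX : X.IsInjective) (hY : Y.IsInjective) :
    (prodObj X Y).IsInjective := fun A B i hi f => by
  obtain ⟨g, hg⟩ := hX A B i hi (f ≫ prodFst X Y)
  obtain ⟨k, hk⟩ := hY A B i hi (f ≫ prodSnd X Y)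
  exact ⟨prodLift g k, fun x => ⟨le_inf (hg x).1 (hk x).1, le_inf (hg x).2 (hk x).2⟩⟩

open scoped Quantale in
/-- The extension of `f : A ⟶ self V` along `i : A ⟶ B` is the left Kan extension
`b ↦ ⋁ a, f a * B.dist (i a) b`. -/
theorem isInjective_self : (self.{w} V).IsInjective := fun A B i hi f => by
  have hf : ∀ a a', (f.toFun a).down * A.dist a a' ≤ (f.toFun a').down := fun a a' =>
    Quantale.rightMulResiduation_le_iff_mul_le.1 (f.dist_le a a')
  refine ⟨Hom.mk (fun b => ⟨⨆ a, (f.toFun a).down * B.dist (i.toFun a) b⟩) fun b b' =>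
    Quantale.rightMulResiduation_le_iff_mul_le.2 ?_, fun a => ⟨?_, ?_⟩⟩
  · rw [Quantale.iSup_mul_distrib]
    refine iSup_mono fun a => ?_
    rw [mul_assoc]
    exact mul_le_mul' le_rfl (B.dist_mul_dist_le _ _ _)
  · refine Quantale.rightMulResiduation_le_iff_mul_le.2 ((mul_one _).trans_le ?_)
    exact iSup_le fun a' => (hi a' a).symm ▸ hf a' a
  · refine Quantale.rightMulResiduation_le_iff_mul_le.2 ?_
    exact le_iSup_of_le a (mul_le_mul' le_rfl (B.one_le_dist _))

/-- The chosen product of two injective `V`-categories, in the full subcategory. -/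
def injProd (X Y : ObjectProperty.FullSubcategory (IsInjective (V := V))) :
    ObjectProperty.FullSubcategory (IsInjective.{w} (V := V)) :=
  ⟨prodObj X.obj Y.obj, X.property.prodObj Y.property⟩

/-- `injProd X Y` with its projections is a categorical product. -/
def injProdIsLimit (X Y : ObjectProperty.FullSubcategory (IsInjective.{w} (V := V))) :
    IsLimit (BinaryFan.mk (P := injProd X Y) (ObjectProperty.homMk (prodFst X.obj Y.obj))
      (ObjectProperty.homMk (prodSnd X.obj Y.obj))) :=
  BinaryFan.isLimitMk (fun s => ObjectProperty.homMk (prodLift s.fst.hom s.snd.hom))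
    (fun _ => rfl) (fun _ => rfl) fun _ _ h₁ h₂ => ObjectProperty.hom_ext _ <| hom_ext fun t =>
      Prod.ext (congrArg (fun f => Hom.toFun f.hom t) h₁)
        (congrArg (fun f => Hom.toFun f.hom t) h₂)

/-! ### Exponentials of enriched categories -/

/-- The interpolation condition on `V`-categories that makes them exponentiable. -/
def IsInterpolating (X : VCat.{w} V) : Prop :=
  ∀ x z u v, X.dist x z ⊓ (u * v) ≤ ⨆ y, (X.dist x y ⊓ u) * (X.dist y z ⊓ v)

/-- The distance of the exponential: the largest `u` such that
`X.dist x x' ⊓ u ≤ Y.dist (f x) (g x')` for all `x` and `x'`. -/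
def expDist {X Y : VCat.{w} V} (f g : X ⟶ Y) : V :=
  sSup {u | ∀ x x', X.dist x x' ⊓ u ≤ Y.dist (f.toFun x) (g.toFun x')}

open CartesianQuantale

variable [CartesianQuantale V]

theorem le_dist_self (X : VCat.{w} V) (x : X.carrier) (u : V) : u ≤ X.dist x x :=
  (le_one u).trans (X.one_le_dist x)

theorem le_expDist {X Y : VCat.{w} V} {f g : X ⟶ Y} {u : V} :
    u ≤ expDist f g ↔ ∀ x x', X.dist x x' ⊓ u ≤ Y.dist (f.toFun x) (g.toFun x') := by
  refine ⟨fun h x x' => (inf_le_inf_left _ h).trans ?_, fun h => le_sSup h⟩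
  exact (inf_sSup_le _ _).trans (iSup₂_le fun s hs => hs x x')

/-- The underlying order of the exponential is pointwise. -/
theorem one_le_expDist {X Y : VCat.{w} V} {f g : X ⟶ Y}
    (h : ∀ x, 1 ≤ Y.dist (f.toFun x) (g.toFun x)) : 1 ≤ expDist f g := by
  refine le_expDist.2 fun x x' => inf_le_left.trans ?_
  calc X.dist x x' = 1 * X.dist x x' := (one_mul _).symm
    _ ≤ _ := mul_le_mul' (h x) (g.dist_le x x')
    _ ≤ _ := Y.dist_mul_dist_le _ _ _

/-- The exponential `Y ^ X`. Its points are the `V`-functors `X ⟶ Y`, because the neutral element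
of `V` is the top element. -/
def exp {X : VCat.{w} V} (hX : X.IsInterpolating) (Y : VCat.{w} V) : VCat.{w} V where
  carrier := X ⟶ Y
  dist := expDist
  one_le_dist f := le_expDist.2 fun x x' => inf_le_left.trans (f.dist_le x x')
  dist_mul_dist_le _ _ _ := le_expDist.2 fun x z => (hX x z _ _).trans <| iSup_le fun y =>
    (mul_le_mul' (le_expDist.1 le_rfl x y) (le_expDist.1 le_rfl y z)).trans
      (Y.dist_mul_dist_le _ _ _)

/-- The universal property of the exponential. -/
def curry {X : VCat.{w} V} (hX : X.IsInterpolating) (A Y : VCat.{w} V) :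
    (prodObj X A ⟶ Y) ≃ (A ⟶ exp hX Y) where
  toFun h := Hom.mk
    (fun a => Hom.mk (fun x => h.toFun (x, a)) fun x x' =>
      (le_inf le_rfl (A.le_dist_self a _)).trans (h.dist_le (x, a) (x', a)))
    fun a a' => le_expDist.2 fun x x' => h.dist_le (x, a) (x', a')
  invFun h := Hom.mk (fun p => (h.toFun p.2).toFun p.1) fun p q =>
    (inf_le_inf_left _ (h.dist_le p.2 q.2)).trans (le_expDist.1 le_rfl p.1 q.1)
  left_inv _ := rfl
  right_inv _ := rfl

theorem IsInterpolating.isExponentiableObject {X : VCat.{w} V} (hX : X.IsInterpolating) :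
    IsExponentiableObject X := by
  refine isExponentiableObject_of_equiv (prodObj X) (prodFst X) (prodSnd X) (prodIsLimit X)
    (exp hX) (curry hX) fun {A A' Y} f p g h₁ h₂ => ?_
  obtain rfl : p = prodLift (prodFst X A') (prodSnd X A' ≫ f) := hom_ext fun t =>
    Prod.ext (congrArg (fun k => Hom.toFun k t) h₁) (congrArg (fun k => Hom.toFun k t) h₂)
  rfl

/-! ### Injective enriched categories are interpolating -/

/-- The chain `0 → 1` with distance `w` from `0` to `1` and `⊥` backwards. -/
def chainTwo (w : V) : VCat.{w} V where
  carrier := ULift Bool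
  dist
    | ⟨false⟩, ⟨true⟩ => w
    | ⟨true⟩, ⟨false⟩ => ⊥
    | _, _ => 1
  one_le_dist := by rintro ⟨_ | _⟩ <;> exact le_rfl
  dist_mul_dist_le := by
    rintro ⟨_ | _⟩ ⟨_ | _⟩ ⟨_ | _⟩ <;> simp [Quantale.bot_mul, Quantale.mul_bot, le_one]

/-- The chain `0 → m → 1`, where `m` is `none`, with distances `u` from `0` to `m`, `v` from `m`
to `1`, `w` from `0` to `1`, and `⊥` backwards. -/
def chainThree (u v w : V) (h : u * v ≤ w) : VCat.{w} V where
  carrier := ULift (Option Bool)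
  dist
    | ⟨some false⟩, ⟨none⟩ => u
    | ⟨none⟩, ⟨some true⟩ => v
    | ⟨some false⟩, ⟨some true⟩ => w
    | ⟨none⟩, ⟨some false⟩ => ⊥
    | ⟨some true⟩, ⟨none⟩ => ⊥
    | ⟨some true⟩, ⟨some false⟩ => ⊥
    | _, _ => 1
  one_le_dist := by rintro ⟨_ | _ | _⟩ <;> exact le_rfl
  dist_mul_dist_le := by
    rintro ⟨_ | _ | _⟩ ⟨_ | _ | _⟩ ⟨_ | _ | _⟩ <;>
      simp [Quantale.bot_mul, Quantale.mul_bot, le_one, h]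

/-- The middle point comes from extending `0 ↦ x`, `1 ↦ z` along `chainTwo ⟶ chainThree`. -/
theorem IsInjective.exists_between {X : VCat.{w} V} (hX : X.IsInjective) {x z : X.carrier}
    {u v : V} (h : u * v ≤ X.dist x z) : ∃ y, u ≤ X.dist x y ∧ v ≤ X.dist y z := by
  let i : chainTwo.{w} (X.dist x z) ⟶ chainThree.{w} u v (X.dist x z) h :=
    Hom.mk (fun b => ⟨some b.down⟩) (by rintro ⟨_ | _⟩ ⟨_ | _⟩ <;> exact le_rfl)
  let f : chainTwo.{w} (X.dist x z) ⟶ X := Hom.mk (fun b => bif b.down then z else x) (by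
    rintro ⟨_ | _⟩ ⟨_ | _⟩
    exacts [X.one_le_dist x, le_rfl, bot_le, X.one_le_dist z])
  obtain ⟨g, hg⟩ := hX _ _ i (by rintro ⟨_ | _⟩ ⟨_ | _⟩ <;> rfl) f
  have h₀ := (hg ⟨false⟩).2
  have h₁ := (hg ⟨true⟩).1
  refine ⟨g.toFun ⟨none⟩, ?_, ?_⟩
  · calc u = 1 * u := (one_mul u).symm
      _ ≤ _ := mul_le_mul' h₀ (g.dist_le ⟨some false⟩ ⟨none⟩)
      _ ≤ _ := X.dist_mul_dist_le _ _ _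
  · calc v = v * 1 := (mul_one v).symm
      _ ≤ _ := mul_le_mul' (g.dist_le ⟨none⟩ ⟨some true⟩) h₁
      _ ≤ _ := X.dist_mul_dist_le _ _ _

theorem IsInjective.isInterpolating {X : VCat.{w} V} (hX : X.IsInjective) :
    X.IsInterpolating := fun x z u v =>
  inf_mul_le u v _ _ fun u' hu v' hv h => by
    obtain ⟨y, hy₁, hy₂⟩ := hX.exists_between h
    exact le_iSup_of_le y (mul_le_mul' (le_inf hy₁ hu) (le_inf hy₂ hv))

/-! ### Cartesian closedness of injective enriched categories -/

theorem IsInjective.exp {X Y : VCat.{w} V} (hX : X.IsInterpolating) (hY : Y.IsInjective) :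
    (exp hX Y).IsInjective := fun A B i hi f => by
  -- `X × i` is again fully faithful, so the transpose of `f` extends along it.
  obtain ⟨g, hg⟩ := hY (VCat.prodObj X A) (VCat.prodObj X B)
    (prodLift (prodFst X A) (prodSnd X A ≫ i))
    (fun p q => congrArg (X.dist p.1 q.1 ⊓ ·) (hi p.2 q.2)) ((curry hX A Y).symm f)
  exact ⟨curry hX B Y g, fun a =>
    ⟨one_le_expDist fun x => (hg (x, a)).1, one_le_expDist fun x => (hg (x, a)).2⟩⟩

theorem isCartesianClosed_isInjective :
    IsCartesianClosed (ObjectProperty.FullSubcategory (IsInjective.{w} (V := V))) := by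
  have : HasTerminal (ObjectProperty.FullSubcategory (IsInjective.{w} (V := V))) :=
    IsTerminal.hasTerminal (X := ⟨terminal.{w} V, isInjective_terminal⟩) <|
      IsTerminal.ofUniqueHom (fun _ => ObjectProperty.homMk ((terminalIsTerminal V).from _))
        fun _ _ => rfl
  have : ∀ X Y : ObjectProperty.FullSubcategory (IsInjective.{w} (V := V)),
      HasLimit (pair X Y) := fun X Y => ⟨⟨⟨_, injProdIsLimit X Y⟩⟩⟩
  have := hasBinaryProducts_of_hasLimit_pair
    (ObjectProperty.FullSubcategory (IsInjective.{w} (V := V)))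
  have : HasFiniteProducts (ObjectProperty.FullSubcategory (IsInjective.{w} (V := V))) :=
    hasFiniteProducts_of_has_binary_and_terminal
  refine ⟨this, fun X => ?_⟩
  have hX := X.property.isInterpolating
  refine isExponentiableObject_of_equiv (injProd X) _ _ (injProdIsLimit X)
    (fun Y => ⟨exp hX Y.obj, Y.property.exp hX⟩)
    (fun A Y =>
      { toFun h := ObjectProperty.homMk (curry hX A.obj Y.obj h.hom)
        invFun h := ObjectProperty.homMk ((curry hX A.obj Y.obj).symm h.hom)
        left_inv _ := rfl
        right_inv _ := rfl }) fun {A A' Y} f p g h₁ h₂ => ?_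
  obtain rfl : p = ObjectProperty.homMk
      (prodLift (prodFst X.obj A'.obj) (prodSnd X.obj A'.obj ≫ f.hom)) :=
    ObjectProperty.hom_ext _ <| hom_ext fun t =>
      Prod.ext (congrArg (fun k => Hom.toFun k.hom t) h₁)
        (congrArg (fun k => Hom.toFun k.hom t) h₂)
  rfl

end VCat

/-! ### The quantale of distribution functions -/

namespace DistFun

theorem exists_lt_of_lt_apply {f : DistFun} {t : ℝ≥0∞} {c : I} (h : c < f t) :
    ∃ s < t, c < f s := by
  rw [f.left_continuous t] at h
  simpa only [lt_iSup_iff, exists_prop] using h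

theorem exists_lt_of_lt_apply_mul {f : DistFun} {t : ℝ≥0∞} {c d : I} (h : c < f t * d) :
    ∃ s < t, c < f s * d := by
  rw [f.left_continuous t] at h
  simpa only [iSup_mul, lt_iSup_iff, exists_prop] using h

/-- The step function with value `c` on `(r, ∞]` and `0` on `[0, r]`. -/
noncomputable def step (r : ℝ≥0∞) (c : I) : DistFun :=
  ofLE (fun t => if r < t then c else 0)
    (fun s t h => by
      dsimp only
      split_ifs with h₁ h₂
      exacts [le_rfl, absurd (h₁.trans_le h) h₂, bot_le, le_rfl])
    fun t => by
      split_ifs with h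
      · obtain ⟨s, hrs, hst⟩ := exists_between h
        exact le_iSup₂_of_le s hst (by rw [if_pos hrs])
      · exact bot_le

theorem step_apply (r : ℝ≥0∞) (c : I) (t : ℝ≥0∞) : step r c t = if r < t then c else 0 := rfl

theorem step_le {r : ℝ≥0∞} {c : I} {f : DistFun} (h : c ≤ f r) : step r c ≤ f := fun t => by
  rw [step_apply]
  split_ifs with hr
  exacts [h.trans (f.monotone' hr.le), bot_le]

theorem step_mul_step_le {r s : ℝ≥0∞} {c d : I} {f : DistFun} (h : c * d ≤ f (r + s)) :
    step r c * step s d ≤ f :=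
  mul_le_iff.2 fun p q => by
    rw [step_apply, step_apply]
    split_ifs with hp hq
    exacts [h.trans (f.monotone' (add_le_add hp.le hq.le)), (mul_zero c).trans_le bot_le,
      (zero_mul d).trans_le bot_le, (zero_mul 0).trans_le bot_le]

theorem exists_mul_eq_of_le_mul {a b c : I} (h : c ≤ a * b) : ∃ a' ≤ a, a' * b = c := by
  obtain rfl | hb := eq_or_ne b 0
  · exact ⟨0, bot_le, (le_antisymm (h.trans_eq (mul_zero a)) bot_le).symm ▸ mul_zero 0⟩
  have hb' : (0 : ℝ) < b := lt_of_le_of_ne b.2.1 fun e => hb (Subtype.ext e.symm)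
  have h' : (c : ℝ) / b ≤ a := (div_le_iff₀ hb').2 h
  exact ⟨⟨c / b, div_nonneg c.2.1 b.2.1, h'.trans a.2.2⟩, h',
    Subtype.ext (div_mul_cancel₀ _ hb'.ne')⟩

/-- Binary infima are pointwise (unlike infinite ones). -/
theorem inf_apply (f g : DistFun) (t : ℝ≥0∞) : (f ⊓ g) t = f t ⊓ g t := by
  refine le_antisymm (le_inf (inf_le_left (a := f) (b := g) t) (inf_le_right (a := f) (b := g) t))
    ?_
  have h : ofLE (fun t => f t ⊓ g t) (fun s t h => inf_le_inf (f.monotone' h) (g.monotone' h))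
      (fun t => le_of_forall_lt fun c hc => by
        obtain ⟨r, hr, hcr⟩ := exists_lt_of_lt_apply (lt_inf_iff.1 hc).1
        obtain ⟨s, hs, hcs⟩ := exists_lt_of_lt_apply (lt_inf_iff.1 hc).2
        refine (lt_inf_iff.2 ⟨?_, ?_⟩).trans_le
          (le_iSup₂_of_le (f := fun s (_ : s < t) => f s ⊓ g s) (r ⊔ s) (sup_lt_iff.2 ⟨hr, hs⟩)
            le_rfl)
        exacts [hcr.trans_le (f.monotone' le_sup_left),
          hcs.trans_le (g.monotone' le_sup_right)]) ≤ f ⊓ g :=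
    le_inf (fun _ => inf_le_left) fun _ => inf_le_right
  exact h t

theorem inf_sSup_le (f : DistFun) (S : Set DistFun) : f ⊓ sSup S ≤ ⨆ g ∈ S, f ⊓ g := fun t => by
  rw [inf_apply, sSup_apply, inf_iSup₂_eq]
  refine iSup₂_le fun g hg => ?_
  rw [← inf_apply]
  exact le_iSup₂ (f := fun g (_ : g ∈ S) => f ⊓ g) g hg t

theorem inf_mul_le (u v w q : DistFun)
    (H : ∀ u' ≤ u, ∀ v' ≤ v, u' * v' ≤ w → u' * v' ≤ q) : w ⊓ (u * v) ≤ q := fun t => by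
  rw [inf_apply, mul_apply, inf_iSup₂_eq]
  refine iSup₂_le fun r s => ?_
  rw [inf_iSup_eq]
  refine iSup_le fun hrs => ?_
  -- Enlarging `s` gives `r + s = t`, so that sums of numbers below `r` and `s` come close to `t`,
  -- where `w` is evaluated.
  obtain ⟨d, rfl⟩ := le_iff_exists_add.1 hrs
  rw [add_assoc]
  refine (inf_le_inf_left _ (mul_le_mul_right (v.monotone' (le_add_right le_rfl : s ≤ s + d))
    _)).trans ?_
  generalize s + d = s
  refine le_of_forall_lt_imp_le_of_dense fun c hc => ?_
  obtain ⟨hw, huv⟩ := lt_inf_iff.1 hc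
  have hr : r ≠ 0 := by
    rintro rfl
    rw [u.apply_zero, zero_mul] at huv
    exact not_lt_bot huv
  have hs : s ≠ 0 := by
    rintro rfl
    rw [v.apply_zero, mul_zero] at huv
    exact not_lt_bot huv
  obtain ⟨τ, hτ, hcτ⟩ := exists_lt_of_lt_apply hw
  obtain ⟨r₀, hr₀, s₀, hs₀, hτ₀⟩ := ENNReal.exists_lt_add_of_lt_add hτ hr hs
  obtain ⟨r₁, hr₁, h₁⟩ := exists_lt_of_lt_apply_mul huv
  rw [mul_comm] at h₁
  obtain ⟨s₁, hs₁, h₁⟩ := exists_lt_of_lt_apply_mul h₁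
  rw [mul_comm] at h₁
  have hcuv : c ≤ u (r₀ ⊔ r₁) * v (s₀ ⊔ s₁) :=
    h₁.le.trans (mul_le_mul' (u.monotone' le_sup_right) (v.monotone' le_sup_right))
  have hcw : c ≤ w (r₀ ⊔ r₁ + s₀ ⊔ s₁) :=
    hcτ.le.trans (w.monotone' (hτ₀.le.trans (add_le_add le_sup_left le_sup_left)))
  -- The product of the steps of heights `a` and `v (s₀ ⊔ s₁)` has value `c` at `r + s`, and is
  -- below `w` because `c ≤ w (r₀ ⊔ r₁ + s₀ ⊔ s₁)`.
  obtain ⟨a, ha, rfl⟩ := exists_mul_eq_of_le_mul hcuv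
  have h := mul_le_iff.1 (H _ (step_le ha) _ (step_le le_rfl) (step_mul_step_le hcw)) r s
  rwa [step_apply, step_apply, if_pos (sup_lt_iff.2 ⟨hr₀, hr₁⟩),
    if_pos (sup_lt_iff.2 ⟨hs₀, hs₁⟩)] at h

instance : CartesianQuantale DistFun where
  le_one f t := by
    change f t ≤ (1 : DistFun) t
    rw [one_apply]
    split_ifs with h
    · rw [h, f.apply_zero]
    · exact le_top
  inf_sSup_le := inf_sSup_le
  inf_mul_le := inf_mul_le

end DistFun

theorem mainTheorem3 :
    (∀ X : ProbMet.{w}, X.IsInjective → IsExponentiableObject X) ∧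
    IsExponentiableObject (VCat.self.{w} DistFun : ProbMet.{w}) ∧
    IsCartesianClosed InjProbMet.{w} :=
  ⟨fun _ hX => hX.isInterpolating.isExponentiableObject,
    VCat.isInjective_self.isInterpolating.isExponentiableObject,
    VCat.isCartesianClosed_isInjective⟩
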